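/- Permutation Mastermind on $n\ge 2$ positions: the codemaker holds a secret $\sigma^\star\in S_n$, and a guess $\pi\in S_n$ receives the score $b(\pi,\sigma^\star)=|\{i\in[n]:\pi(i)=\sigma^\star(i)\}|$. A static strategy of length $T$ is a list of guesses $\pi_1,\dots,\pi_T\in S_n$ fixed in advance; it is correct if, for every secret $\sigma^\star$, the codebreaker can name $\sigma^\star$ in one last guess from the scores $b(\pi_1,\sigma^\star),\dots,b(\pi_T,\sigma^\star)$. For $k\ge 2$ the strategy is $\ell_k$-local if $|\{i\in[n]:\pi_t(i)\ne\pi_{t+1}(i)\}|\le k$ for all $1\le t<T$ (the last guess is not restricted). Let $S_\ell(n,k)$ be the minimum length $T$ of a correct $\ell_k$-local static strategy. Theorem. For all $n\ge 2$ and $k\ge 2$ a correct $\ell_k$-local static strategy exists, and $$\frac{n^2-(1+o(1))\,n^{3/2}}{k}\;\le\; S_\ell(n,k)\;\le\; 28\,n\lg n\cdot\left\lceil\frac{n-1}{k-1}\right\rceil ,$$ where $\lg=\log_2$ and the $o(1)$ term is a function of $n$ alone (uniform in $k$) that tends to $0$ as $n\to\infty$. -/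

import Mathlib

open Filter Topology

namespace PermMastermind

/-- The set `D(π, σ)` of positions in which two permutations differ. -/
def diffSet {n : ℕ} (π σ : Equiv.Perm (Fin n)) : Finset (Fin n) :=
  Finset.univ.filter fun i => π i ≠ σ i

/-- The black-peg score `b(π, σ)`: the number of positions in which `π` and `σ` agree. -/
def blackPeg {n : ℕ} (π σ : Equiv.Perm (Fin n)) : ℕ :=
  (Finset.univ.filter fun i => π i = σ i).card

/-- A fixed list of `T` guesses is `ℓ_k`-local if any two consecutive guesses differ in at most
`k` positions. -/
def IsLocal {n T : ℕ} (k : ℕ) (π : Fin T → Equiv.Perm (Fin n)) : Prop :=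
  ∀ (s t : Fin T), (s : ℕ) + 1 = (t : ℕ) → (diffSet (π s) (π t)).card ≤ k

/-- A fixed list of `T` guesses, announced in advance, is a correct static strategy if there is a
rule for the one last guess, which sees only the list of scores and is not subject to any locality
restriction, such that this last guess equals the secret permutation, for every secret. -/
def IsCorrectStatic {n T : ℕ} (π : Fin T → Equiv.Perm (Fin n)) : Prop :=
  ∃ lastGuess : (Fin T → ℕ) → Equiv.Perm (Fin n),
    ∀ secret : Equiv.Perm (Fin n), lastGuess (fun t => blackPeg (π t) secret) = secret

/-- The lengths of the correct `ℓ_k`-local static strategies. -/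
def staticLocalLengths (n k : ℕ) : Set ℕ :=
  {T | ∃ π : Fin T → Equiv.Perm (Fin n), IsLocal k π ∧ IsCorrectStatic π}

/-- `S_ℓ(n, k)`: the minimum length of a correct `ℓ_k`-local static strategy. -/
noncomputable def staticLocalComplexity (n k : ℕ) : ℕ :=
  sInf (staticLocalLengths n k)

end PermMastermind

/-! For the upper bound, `⌊28 n lg n⌋` uniformly random guesses identify every secret with positive
probability (`exists_isCorrectStatic`). Let two secrets `π`, `σ` differ in `d` positions, and let
`A`, `B` be the numbers of these positions where a random guess agrees with `π` and with `σ`. The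
guess separates them exactly if `A ≠ B`. Counting permutations with prescribed values gives
`E (A - B)² ≥ 2 d / n`, while the third factorial moments of `A` and `B` are at most `d / n`; since
`(A - B)² / 9 - (A.choose 3 + B.choose 3) / 4` is at most the indicator of `A ≠ B`, the guess
separates the two secrets with probability at least `d / (8 n)` (`card_separating_ge`). The failure
probability thus decays geometrically in `d`. Close pairs of secrets are numerous, but the event
depends only on the values at the `d` positions, and there are at most `n ^ (3 d)` such patterns, so
the union bound over patterns succeeds.

To make the strategy local, consecutive guesses are joined by paths. A step that moves `k` positions
can repair at least `k - 1` of them, by following cycles (`exists_partial_repair`), so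
`⌈(n - 1) / (k - 1)⌉` steps join any two permutations (`exists_local_path`).

For the lower bound, say that a guess visits the cells `(i, π i)` of the `n × n` board. Two secrets
that differ by exchanging two values are separated only by a guess that visits one of the four cells
of a rectangle, so for a correct strategy the unvisited cells contain no rectangle, and by the
Kővári–Sós–Turán argument there are at most `n ^ (3 / 2) + n` of them (`card_le_of_rectangle_free`).
Locality limits the number of visited cells to `n + T k` (`card_visited_le`). Together these give
`T k ≥ n² - n ^ (3 / 2) - 2 n`, whence the error term `2 / √n`. -/

/-! ### A random guess separates two fixed secrets -/

namespace PermMastermind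

open Finset in
/-- The permutations that extend a given injection on `s` correspond to the bijections between the
complements of `s` and of its image. -/
theorem card_perm_extending {n : ℕ} (s : Finset (Fin n)) (f : Fin n → Fin n)
    (hf : Set.InjOn f s) :
    #{τ : Equiv.Perm (Fin n) | ∀ i ∈ s, τ i = f i} = (n - #s).factorial := by
  classical
  let e₀ : (s : Set (Fin n)) ≃ (f '' s : Set (Fin n)) := Equiv.Set.imageOfInjOn f s hf
  have e := Equiv.Set.compl e₀
  have hs : Fintype.card ((s : Set (Fin n))ᶜ : Set (Fin n)) = n - #s := by
    rw [Fintype.card_compl_set]; simp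
  have ht : Fintype.card ((f '' s : Set (Fin n))ᶜ : Set (Fin n)) = n - #s := by
    rw [Fintype.card_compl_set, ← Fintype.card_congr e₀]; simp
  have e₁ : {τ : Equiv.Perm (Fin n) // ∀ i ∈ s, τ i = f i} ≃
      {τ : Fin n ≃ Fin n // ∀ x : (s : Set (Fin n)), τ x = e₀ x} :=
    Equiv.subtypeEquivRight fun τ => by
      simp [e₀, Equiv.Set.imageOfInjOn]
  rw [← Fintype.card_subtype, Fintype.card_congr (e₁.trans e),
    Fintype.card_equiv (Fintype.equivOfCardEq (hs.trans ht.symm)), hs]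

open Finset in
/-- The factorial moments of the number of agreements of a random permutation with `π` on `D`. -/
theorem sum_choose_card_agree {n : ℕ} (D : Finset (Fin n)) (π : Equiv.Perm (Fin n)) (r : ℕ) :
    ∑ τ : Equiv.Perm (Fin n), (#{i ∈ D | τ i = π i}).choose r
      = (#D).choose r * (n - r).factorial := by
  classical
  have h : ∀ τ : Equiv.Perm (Fin n), (#{i ∈ D | τ i = π i}).choose r
      = ∑ s ∈ D.powersetCard r, if ∀ i ∈ s, τ i = π i then 1 else 0 := by
    intro τ
    rw [← card_powersetCard, ← card_filter]
    congr 1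
    ext s
    simp only [mem_powersetCard, mem_filter, subset_iff]
    grind
  simp_rw [h]
  rw [sum_comm, ← card_powersetCard, ← smul_eq_mul, ← sum_const]
  refine sum_congr rfl fun s hs => ?_
  rw [← card_filter, card_perm_extending s π π.injective.injOn, (mem_powersetCard.1 hs).2]

open Finset in
theorem card_perm_two_values {n : ℕ} {i j a b : Fin n} (hij : i ≠ j) (hab : a ≠ b) :
    #{τ : Equiv.Perm (Fin n) | τ i = a ∧ τ j = b} = (n - 2).factorial := by
  classical
  have h := card_perm_extending {i, j} (fun x => if x = i then a else b) (by
    intro x hx y hy hxy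
    simp only [coe_insert, coe_singleton, Set.mem_insert_iff, Set.mem_singleton_iff] at hx hy
    grind)
  rw [card_pair hij] at h
  rw [← h]
  congr 1
  ext τ
  simp [hij.symm]

open Finset in
/-- For a position `i` where `π` and `σ` differ, `π i` is taken by `σ` at a second position, also in
the difference set, so that at most `d² - 2d` pairs of positions contribute to the mixed moment. -/
theorem sum_agree_mul_agree_le {n : ℕ} (π σ : Equiv.Perm (Fin n)) :
    ∑ τ : Equiv.Perm (Fin n),
        #{i ∈ diffSet π σ | τ i = π i} * #{i ∈ diffSet π σ | τ i = σ i}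
      + 2 * #(diffSet π σ) * (n - 2).factorial
      ≤ #(diffSet π σ) ^ 2 * (n - 2).factorial := by
  classical
  set D := diffSet π σ with hD
  have hmem : ∀ i, i ∈ D ↔ π i ≠ σ i := by simp [hD, diffSet]
  have h : ∀ τ : Equiv.Perm (Fin n), #{i ∈ D | τ i = π i} * #{i ∈ D | τ i = σ i}
      = ∑ p ∈ D ×ˢ D, if τ p.1 = π p.1 ∧ τ p.2 = σ p.2 then 1 else 0 := by
    intro τ
    rw [← card_filter, ← card_product, ← filter_product]
  simp_rw [h]
  rw [sum_comm]
  simp_rw [← card_filter]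
  have hle : ∀ i ∈ D, ∑ j ∈ D, #{τ : Equiv.Perm (Fin n) | τ i = π i ∧ τ j = σ j}
      + 2 * (n - 2).factorial ≤ #D * (n - 2).factorial := by
    intro i hi
    set i' := σ.symm (π i) with hi'
    have hσi' : σ i' = π i := by simp [hi']
    have hne : i ≠ i' := fun he => (hmem i).1 hi (by rw [← hσi', ← he])
    have hi'D : i' ∈ D := (hmem i').2 fun he => hne (π.injective (by rw [he, hσi']))
    have hsub : {i, i'} ⊆ D := by
      intro x hx; simp at hx; rcases hx with rfl | rfl <;> assumption
    have hz : ∀ j ∈ ({i, i'} : Finset (Fin n)),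
        #{τ : Equiv.Perm (Fin n) | τ i = π i ∧ τ j = σ j} = 0 := by
      intro j hj
      rw [card_eq_zero, filter_eq_empty_iff]
      rintro τ - ⟨h1, h2⟩
      simp only [mem_insert, mem_singleton] at hj
      rcases hj with rfl | rfl
      · exact (hmem j).1 hi (h1.symm.trans h2)
      · exact hne (τ.injective (by rw [h1, h2, hσi']))
    have h2 : ∀ j ∈ D \ {i, i'},
        #{τ : Equiv.Perm (Fin n) | τ i = π i ∧ τ j = σ j} = (n - 2).factorial := by
      intro j hj
      simp only [Finset.mem_sdiff, mem_insert, mem_singleton, not_or] at hj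
      refine card_perm_two_values (Ne.symm hj.2.1) fun he => hj.2.2 (σ.injective ?_)
      rw [hσi', he]
    rw [← sum_sdiff hsub, sum_congr rfl h2, sum_eq_zero hz, sum_const, smul_eq_mul, add_zero,
      ← add_mul, ← card_pair hne, card_sdiff_add_card_eq_card hsub]
  rw [sum_product]
  calc _ = ∑ i ∈ D, (∑ j ∈ D, #{τ : Equiv.Perm (Fin n) | τ i = π i ∧ τ j = σ j}
        + 2 * (n - 2).factorial) := by
        rw [sum_add_distrib, sum_const, smul_eq_mul]; ring
    _ ≤ ∑ _i ∈ D, #D * (n - 2).factorial := sum_le_sum hle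
    _ = _ := by rw [sum_const, smul_eq_mul]; ring

theorem four_mul_sq_le_choose_three (m : ℕ) : 4 * m ^ 2 ≤ 36 + 9 * m.choose 3 := by
  induction m using Nat.strong_induction_on with
  | _ m ih =>
    rcases lt_or_ge m 6 with h | h
    · interval_cases m <;> simp [Nat.choose]
    · obtain ⟨m, rfl⟩ := Nat.exists_eq_add_of_le' (show 1 ≤ m by lia)
      have h1 := ih m (by lia)
      have h2 : m.choose 2 = m * (m - 1) / 2 := Nat.choose_two_right m
      have h3 : 2 * m ≤ m * (m - 1) / 2 := by
        rw [Nat.le_div_iff_mul_le (by norm_num)]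
        have : 4 ≤ m - 1 := by lia
        nlinarith
      rw [show (m + 1).choose 3 = m.choose 2 + m.choose 3 from Nat.choose_succ_succ m 2]
      nlinarith

/-- A lower bound for the indicator of `a ≠ b` with easily computed mean. The constants are chosen
so that the quadratic term still dominates after averaging. -/
theorem sq_sub_le_indicator (a b : ℕ) :
    ((a : ℝ) - b) ^ 2 / 9 - ((a.choose 3 : ℝ) + b.choose 3) / 4 ≤ if a ≠ b then 1 else 0 := by
  have key : ∀ m : ℕ, (m : ℝ) ^ 2 / 9 ≤ 1 + (m.choose 3 : ℝ) / 4 := by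
    intro m
    have h : (4 : ℝ) * (m : ℝ) ^ 2 ≤ 36 + 9 * (m.choose 3 : ℝ) := by
      exact_mod_cast four_mul_sq_le_choose_three m
    linarith
  have ha : (0 : ℝ) ≤ a := a.cast_nonneg
  have hb : (0 : ℝ) ≤ b := b.cast_nonneg
  have ha3 : (0 : ℝ) ≤ a.choose 3 := Nat.cast_nonneg _
  have hb3 : (0 : ℝ) ≤ b.choose 3 := Nat.cast_nonneg _
  split_ifs with h
  · rcases le_total (a : ℝ) b with hab | hab
    · have : ((a : ℝ) - b) ^ 2 ≤ (b : ℝ) ^ 2 := by nlinarith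
      linarith [key b]
    · have : ((a : ℝ) - b) ^ 2 ≤ (a : ℝ) ^ 2 := by nlinarith
      linarith [key a]
  · rw [not_not.1 h]
    simp only [sub_self]
    linarith

open Finset in
/-- The permutations `τ` for which the agreements with `π` and with `σ` on their difference set
differ in number make up a proportion of at least `d / (8 n)`. -/
theorem card_separating_ge {n : ℕ} (π σ : Equiv.Perm (Fin n)) :
    (#(diffSet π σ) : ℝ) * n.factorial ≤ 8 * n *
      #{τ : Equiv.Perm (Fin n) |
        #{i ∈ diffSet π σ | τ i = π i} ≠ #{i ∈ diffSet π σ | τ i = σ i}} := by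
  classical
  set D := diffSet π σ with hD
  rcases Nat.lt_or_ge n 2 with hn | hn
  · have : D = ∅ := by
      have : Subsingleton (Fin n) := Fin.subsingleton_iff_le_one.2 (by lia)
      rw [Finset.eq_empty_iff_forall_notMem]
      intro i
      simp [hD, diffSet, Subsingleton.elim π σ]
    rw [this]; simp
  set A : Equiv.Perm (Fin n) → ℕ := fun τ => #{i ∈ D | τ i = π i} with hA
  set B : Equiv.Perm (Fin n) → ℕ := fun τ => #{i ∈ D | τ i = σ i} with hB
  set d : ℝ := (#D : ℝ) with hd
  have hdn : #D ≤ n := by simpa using card_le_univ D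
  have hd0 : 0 ≤ d := Nat.cast_nonneg _
  obtain ⟨m, rfl⟩ := Nat.exists_eq_add_of_le' hn
  set F : ℝ := (m.factorial : ℝ) with hF
  have hF0 : 0 ≤ F := Nat.cast_nonneg _
  have hm0 : (0 : ℝ) ≤ m := m.cast_nonneg
  have hf1 : ((m + 1).factorial : ℝ) = (m + 1) * F := by
    rw [Nat.factorial_succ]; push_cast; ring
  have hf2 : ((m + 2).factorial : ℝ) = (m + 2) * ((m + 1) * F) := by
    rw [Nat.factorial_succ, Nat.cast_mul, hf1]; push_cast; ring
  have m1 : ∀ ρ : Equiv.Perm (Fin (m + 2)),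
      ∑ τ : Equiv.Perm (Fin (m + 2)), (#{i ∈ D | τ i = ρ i} : ℝ) = d * ((m + 1) * F) := by
    intro ρ
    have := sum_choose_card_agree D ρ 1
    simp only [Nat.choose_one_right] at this
    rw [← hf1, hd]
    exact_mod_cast this
  have m2 : ∀ ρ : Equiv.Perm (Fin (m + 2)),
      ∑ τ : Equiv.Perm (Fin (m + 2)), ((#{i ∈ D | τ i = ρ i}).choose 2 : ℝ)
        = d * (d - 1) / 2 * F := by
    intro ρ
    have := sum_choose_card_agree D ρ 2
    rw [← Nat.cast_choose_two, hF]
    exact_mod_cast this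
  have m3 : ∀ ρ : Equiv.Perm (Fin (m + 2)),
      ∑ τ : Equiv.Perm (Fin (m + 2)), ((#{i ∈ D | τ i = ρ i}).choose 3 : ℝ)
        ≤ d * ((m + 1) * F) / 6 := by
    intro ρ
    have h := sum_choose_card_agree D ρ 3
    have h' : ∑ τ : Equiv.Perm (Fin (m + 2)), ((#{i ∈ D | τ i = ρ i}).choose 3 : ℝ)
        = ((#D).choose 3 : ℝ) * ((m + 2 - 3).factorial : ℝ) := by exact_mod_cast h
    rw [h']
    rcases Nat.lt_or_ge (#D) 3 with h3 | h3
    · rw [Nat.choose_eq_zero_of_lt h3]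
      simp only [Nat.cast_zero, zero_mul]
      positivity
    · obtain ⟨q, rfl⟩ := Nat.exists_eq_add_of_le' (show 1 ≤ m by lia)
      have hc : ((#D).choose 3 : ℝ) * 6 = d * (d - 1) * (d - 2) := by
        obtain ⟨e, he⟩ := Nat.exists_eq_add_of_le' h3
        have h4 := Nat.descFactorial_eq_factorial_mul_choose (e + 3) 3
        rw [hd, he]
        simp only [Nat.descFactorial_succ, Nat.descFactorial_zero, Nat.factorial] at h4
        have h5 : ((e + 3 - 2 : ℕ) : ℝ) * (((e + 3 - 1 : ℕ) : ℝ) * (((e + 3 - 0 : ℕ) : ℝ) * 1))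
            = 6 * ((e + 3).choose 3 : ℝ) := by exact_mod_cast h4
        rw [show e + 3 - 2 = e + 1 by lia, show e + 3 - 1 = e + 2 by lia] at h5
        push_cast at h5 ⊢
        linarith
      have hF' : F = (q + 1) * (q.factorial : ℝ) := by
        rw [hF, Nat.factorial_succ]; push_cast; ring
      have hdq : d ≤ q + 3 := by
        have : (#D : ℝ) ≤ ((q + 1 + 2 : ℕ) : ℝ) := by exact_mod_cast hdn
        push_cast at this; linarith
      have hd3 : (3 : ℝ) ≤ d := by rw [hd]; exact_mod_cast h3
      have hq0 : (0 : ℝ) ≤ q.factorial := Nat.cast_nonneg _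
      have hp : (d - 1) * (d - 2) ≤ (q + 2) * (q + 1) :=
        mul_le_mul (by linarith) (by linarith) (by linarith) (by positivity)
      rw [show q + 1 + 2 - 3 = q by lia, hF']
      push_cast
      have := mul_le_mul_of_nonneg_left (mul_le_mul_of_nonneg_right hp hq0) hd0
      nlinarith
  have mAB : ∑ τ : Equiv.Perm (Fin (m + 2)), (A τ : ℝ) * B τ ≤ (d ^ 2 - 2 * d) * F := by
    have h := sum_agree_mul_agree_le π σ
    rw [show m + 2 - 2 = m by lia] at h
    have h' : ∑ τ : Equiv.Perm (Fin (m + 2)), (A τ : ℝ) * B τ + 2 * d * F ≤ d ^ 2 * F := by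
      rw [hd, hF]
      exact_mod_cast h
    linarith
  have hsq : ∀ τ, ((A τ : ℝ) - B τ) ^ 2 = 2 * ((A τ).choose 2 : ℝ) + A τ
      + (2 * ((B τ).choose 2 : ℝ) + B τ) - 2 * ((A τ : ℝ) * B τ) := by
    intro τ
    rw [Nat.cast_choose_two, Nat.cast_choose_two]; ring
  have second : 2 * d * ((m + 1) * F)
      ≤ ∑ τ : Equiv.Perm (Fin (m + 2)), ((A τ : ℝ) - B τ) ^ 2 := by
    simp_rw [hsq]
    rw [sum_sub_distrib, sum_add_distrib, sum_add_distrib, sum_add_distrib, ← mul_sum, ← mul_sum,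
      ← mul_sum, m1 π, m1 σ, m2 π, m2 σ]
    nlinarith [mul_nonneg hd0 hF0]
  have hind : ∑ τ : Equiv.Perm (Fin (m + 2)),
      (((A τ : ℝ) - B τ) ^ 2 / 9 - (((A τ).choose 3 : ℝ) + (B τ).choose 3) / 4)
      ≤ (#{τ : Equiv.Perm (Fin (m + 2)) | A τ ≠ B τ} : ℝ) := by
    rw [card_filter]
    push_cast
    exact sum_le_sum fun τ _ => sq_sub_le_indicator (A τ) (B τ)
  rw [sum_sub_distrib, ← sum_div, ← sum_div, sum_add_distrib] at hind
  have h3π := m3 π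
  have h3σ := m3 σ
  have hfin : d * ((m + 1) * F) / 8 ≤ (#{τ : Equiv.Perm (Fin (m + 2)) | A τ ≠ B τ} : ℝ) := by
    have : 0 ≤ d * ((m + 1) * F) := by positivity
    linarith
  rw [hf2]
  push_cast
  have := mul_le_mul_of_nonneg_left hfin (show (0 : ℝ) ≤ 8 * (m + 2) by positivity)
  linarith

/-! ### Repairing permutations in local steps -/

open Finset in
/-- Changing `x` only on some `j` positions of the difference set makes it agree with `y` on all but
at most one of them. The set of changed positions grows by following `y` along the cycle that contains the one defect. -/
theorem exists_partial_repair {n : ℕ} (x y : Equiv.Perm (Fin n)) (j : ℕ)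
    (hj : j ≤ #(diffSet x y)) :
    ∃ (z : Equiv.Perm (Fin n)) (S : Finset (Fin n)), S ⊆ diffSet x y ∧ #S = j ∧
      (∀ i ∉ S, z i = x i) ∧ #{i ∈ S | z i ≠ y i} ≤ 1 := by
  classical
  induction j with
  | zero => exact ⟨x, ∅, by simp⟩
  | succ j ih =>
    obtain ⟨z, S, hS, hcard, hz, h1⟩ := ih (by lia)
    have hD : ∀ i, i ∈ diffSet x y ↔ x i ≠ y i := by simp [diffSet]
    rcases Finset.eq_empty_or_nonempty {i ∈ S | z i ≠ y i} with h0 | ⟨p, hp⟩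
    · obtain ⟨q, hq, hqS⟩ := exists_mem_notMem_of_card_lt_card (show #S < #(diffSet x y) by lia)
      refine ⟨z, insert q S, insert_subset hq hS, by rw [card_insert_of_notMem hqS, hcard],
        fun i hi => hz i (by simp_all), ?_⟩
      rw [filter_insert, h0]
      split_ifs <;> simp
    · have huniq : ∀ i ∈ S, i ≠ p → z i = y i := by
        intro i hi hip
        by_contra hne
        exact hip (card_le_one.1 h1 i (by simp [hi, hne]) p hp)
      rw [mem_filter] at hp
      set q := z.symm (y p) with hq
      have hzq : z q = y p := by simp [hq]
      have hqp : q ≠ p := fun h => hp.2 (by rw [← hzq, h])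
      have hqS : q ∉ S := fun h => hqp (y.injective (by rw [← huniq q h hqp, hzq]))
      have hqD : q ∈ diffSet x y := (hD q).2 fun h =>
        hqp (y.injective (by rw [← h, ← hz q hqS, hzq]))
      refine ⟨z * Equiv.swap p q, insert q S, insert_subset hqD hS,
        by rw [card_insert_of_notMem hqS, hcard], ?_, ?_⟩
      · intro i hi
        simp only [mem_insert, not_or] at hi
        have hip : i ≠ p := fun h => hi.2 (h ▸ hp.1)
        rw [Equiv.Perm.mul_apply, Equiv.swap_apply_of_ne_of_ne hip hi.1, hz i hi.2]
      · refine (card_le_card (t := {q}) ?_).trans (by simp)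
        intro i hi
        rw [mem_filter, mem_insert, Equiv.Perm.mul_apply] at hi
        rw [mem_singleton]
        by_contra hiq
        rcases hi.1 with h | h
        · exact hiq h
        · by_cases hip : i = p
          · subst hip
            rw [Equiv.swap_apply_left] at hi
            exact hi.2 hzq
          · rw [Equiv.swap_apply_of_ne_of_ne hip hiq] at hi
            exact hi.2 (huniq i h hip)

open Finset in
theorem diffSet_eq_empty_iff {n : ℕ} {x y : Equiv.Perm (Fin n)} : diffSet x y = ∅ ↔ x = y := by
  simp [diffSet, filter_eq_empty_iff, Equiv.ext_iff]

open Finset in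
/-- Two permutations cannot differ in exactly one position. -/
theorem eq_of_card_diffSet_le_one {n : ℕ} {x y : Equiv.Perm (Fin n)}
    (h : #(diffSet x y) ≤ 1) : x = y := by
  ext1 p
  by_contra hp
  have hD : ∀ i, i ∈ diffSet x y ↔ x i ≠ y i := by simp [diffSet]
  have hq : x (x.symm (y p)) = y p := by simp
  have hqp : x.symm (y p) ≠ p := fun h => hp (by rw [← hq, h])
  refine hqp (card_le_one.1 h _ ((hD _).2 fun he => hqp ?_) _ ((hD p).2 hp))
  exact y.injective (by rw [← he, hq])

open Finset in
/-- Each step of the path moves at most `k` positions and reduces the distance to `y` by at least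
`k - 1`, until `y` is reached. -/
theorem exists_local_path {n k : ℕ} (hk : 2 ≤ k) (L : ℕ) (x y : Equiv.Perm (Fin n))
    (h : #(diffSet x y) ≤ 1 + L * (k - 1)) :
    ∃ p : ℕ → Equiv.Perm (Fin n), p 0 = x ∧ p L = y ∧
      ∀ r < L, #(diffSet (p r) (p (r + 1))) ≤ k := by
  classical
  induction L generalizing x with
  | zero =>
    have hxy := eq_of_card_diffSet_le_one (x := x) (y := y) (by lia)
    exact ⟨fun _ => x, rfl, hxy, by simp⟩
  | succ L ih =>
    obtain ⟨z, S, hS, hcard, hz, h1⟩ :=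
      exists_partial_repair x y (min k #(diffSet x y)) (min_le_right _ _)
    have hsub : diffSet z y ⊆ (diffSet x y \ S) ∪ {i ∈ S | z i ≠ y i} := by
      intro i hi
      by_cases hiS : i ∈ S
      · simp_all [diffSet]
      · simp_all [diffSet]
    have hle : #(diffSet z y) ≤ 1 + L * (k - 1) := by
      have h2 := (card_le_card hsub).trans (card_union_le _ _)
      have h3 := card_sdiff_add_card_eq_card hS
      have h4 : (L + 1) * (k - 1) = L * (k - 1) + (k - 1) := by ring
      have h5 : 0 ≤ L * (k - 1) := Nat.zero_le _
      generalize L * (k - 1) = u at *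
      lia
    obtain ⟨p, hp0, hpL, hp⟩ := ih z hle
    refine ⟨fun r => if r = 0 then x else p (r - 1), by simp, by simpa using hpL, ?_⟩
    intro r hr
    rcases r with _ | r
    · have : diffSet x z ⊆ S := by
        intro i hi
        by_contra hiS
        simp [diffSet, hz i hiS] at hi
      simpa [hp0] using (card_le_card this).trans (by rw [hcard]; exact min_le_left _ _)
    · simpa using hp r (by lia)

theorem isCorrectStatic_iff {n T : ℕ} (π : Fin T → Equiv.Perm (Fin n)) :
    IsCorrectStatic π ↔
      Function.Injective fun (secret : Equiv.Perm (Fin n)) (t : Fin T) =>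
        blackPeg (π t) secret := by
  rw [Function.injective_iff_hasLeftInverse]
  rfl

open Finset in
/-- An arbitrary correct strategy becomes local when consecutive guesses are joined by paths. -/
theorem mul_mem_staticLocalLengths {n k M L : ℕ} (hk : 2 ≤ k) (hL : 0 < L)
    (hn : n ≤ 1 + L * (k - 1)) (τ : Fin M → Equiv.Perm (Fin n)) (hτ : IsCorrectStatic τ) :
    M * L ∈ staticLocalLengths n k := by
  classical
  have hpath : ∀ x y : Equiv.Perm (Fin n), ∃ p : ℕ → Equiv.Perm (Fin n),
      p 0 = x ∧ p L = y ∧ ∀ r < L, #(diffSet (p r) (p (r + 1))) ≤ k := fun x y =>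
    exists_local_path hk L x y (((card_le_univ _).trans_eq (by simp)).trans hn)
  choose p hp0 hpL hp using hpath
  let τ' : ℕ → Equiv.Perm (Fin n) := fun t => if h : t < M then τ ⟨t, h⟩ else 1
  let u : ℕ → Equiv.Perm (Fin n) := fun s => p (τ' (s / L)) (τ' (s / L + 1)) (s % L)
  have hu : ∀ s, #(diffSet (u s) (u (s + 1))) ≤ k := by
    intro s
    have hlt := Nat.mod_lt s hL
    have hdm := Nat.div_add_mod s L
    have hkey : u (s + 1) = p (τ' (s / L)) (τ' (s / L + 1)) (s % L + 1) := by
      rcases Nat.lt_or_ge (s % L + 1) L with h | h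
      · have h1 : (s + 1) / L = s / L := by
          conv_lhs => rw [← hdm, add_assoc, Nat.mul_add_div hL, Nat.div_eq_of_lt h, add_zero]
        have h2 : (s + 1) % L = s % L + 1 := by
          have := Nat.div_add_mod (s + 1) L
          rw [h1] at this; lia
        simp only [u, h1, h2]
      · have h0 : s + 1 = L * (s / L + 1) := by rw [mul_add]; lia
        have h1 : (s + 1) / L = s / L + 1 := by rw [h0, Nat.mul_div_cancel_left _ hL]
        have h2 : (s + 1) % L = 0 := by rw [h0, Nat.mul_mod_right]
        have h3 : s % L + 1 = L := by lia
        simp only [u, h1, h2, h3, hp0, hpL]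
    rw [hkey]
    exact hp _ _ _ hlt
  refine ⟨fun s => u s, ?_, ?_⟩
  · intro s t hst
    have h := hu s
    rw [hst] at h
    exact h
  · rw [isCorrectStatic_iff] at hτ ⊢
    intro a b hab
    apply hτ
    funext t
    have hlt : t.1 * L < M * L := Nat.mul_lt_mul_of_pos_right t.2 hL
    have h := congrFun hab ⟨t.1 * L, hlt⟩
    have hut : u (t.1 * L) = τ t := by
      simp [u, Nat.mul_div_cancel _ hL, hp0, τ']
    simpa [hut] using h

/-! ### Random guesses identify every secret -/

open Finset in
/-- The restriction of a pair of permutations to its difference set, as a set of triples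
`(i, π i, σ i)`. Whether a guess separates `π` from `σ` depends on these data alone. -/
def diffPattern {n : ℕ} (π σ : Equiv.Perm (Fin n)) : Finset (Fin n × Fin n × Fin n) :=
  (diffSet π σ).image fun i => (i, π i, σ i)

open Finset in
/-- The guesses `τ` for which `τ i = a` holds for as many triples `(i, a, b)` of the pattern as
`τ i = b`. -/
def balancedGuesses {n : ℕ} (S : Finset (Fin n × Fin n × Fin n)) : Finset (Equiv.Perm (Fin n)) :=
  {τ | #{p ∈ S | τ p.1 = p.2.1} = #{p ∈ S | τ p.1 = p.2.2}}

open Finset in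
theorem card_diffPattern {n : ℕ} (π σ : Equiv.Perm (Fin n)) :
    #(diffPattern π σ) = #(diffSet π σ) :=
  card_image_of_injective _ fun _ _ h => (Prod.ext_iff.1 h).1

open Finset in
theorem mem_balancedGuesses_diffPattern {n : ℕ} {π σ τ : Equiv.Perm (Fin n)} :
    τ ∈ balancedGuesses (diffPattern π σ) ↔
      #{i ∈ diffSet π σ | τ i = π i} = #{i ∈ diffSet π σ | τ i = σ i} := by
  have hinj : Function.Injective fun i => (i, π i, σ i) := fun _ _ h => (Prod.ext_iff.1 h).1
  simp only [balancedGuesses, diffPattern, mem_filter_univ, filter_image,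
    card_image_of_injective _ hinj]

open Finset in
theorem mem_balancedGuesses_of_blackPeg_eq {n : ℕ} {π σ τ : Equiv.Perm (Fin n)}
    (h : blackPeg τ π = blackPeg τ σ) : τ ∈ balancedGuesses (diffPattern π σ) := by
  rw [mem_balancedGuesses_diffPattern]
  -- Off the difference set, `τ` agrees with `π` exactly where it agrees with `σ`.
  have hsplit : ∀ ρ : Equiv.Perm (Fin n), blackPeg τ ρ
      = #{i ∈ diffSet π σ | τ i = ρ i} + #{i ∈ (diffSet π σ)ᶜ | τ i = ρ i} := by
    intro ρ
    rw [← card_union_of_disjoint (disjoint_filter_filter disjoint_compl_right),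
      ← filter_union, union_compl]
    rfl
  have hoff : #{i ∈ (diffSet π σ)ᶜ | τ i = π i} = #{i ∈ (diffSet π σ)ᶜ | τ i = σ i} := by
    congr 1
    refine filter_congr fun i hi => ?_
    have : π i = σ i := by simpa [diffSet] using hi
    rw [this]
  have h1 := hsplit π
  have h2 := hsplit σ
  lia

open Finset in
theorem card_balancedGuesses_le {n : ℕ} (hn : 0 < n) (π σ : Equiv.Perm (Fin n)) :
    (#(balancedGuesses (diffPattern π σ)) : ℝ)
      ≤ n.factorial * Real.exp (-(#(diffPattern π σ) / (8 * n) : ℝ)) := by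
  have h := card_separating_ge π σ
  have hc : #(balancedGuesses (diffPattern π σ)) + #{τ : Equiv.Perm (Fin n) |
      #{i ∈ diffSet π σ | τ i = π i} ≠ #{i ∈ diffSet π σ | τ i = σ i}} = n.factorial := by
    have h1 := card_filter_add_card_filter_not (s := (univ : Finset (Equiv.Perm (Fin n))))
      (fun τ => #{i ∈ diffSet π σ | τ i = π i} = #{i ∈ diffSet π σ | τ i = σ i})
    rw [card_univ, Fintype.card_perm, Fintype.card_fin] at h1
    rw [← h1]
    congr 2
    ext τ
    rw [mem_balancedGuesses_diffPattern, mem_filter_univ]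
  have hc' : (#(balancedGuesses (diffPattern π σ)) : ℝ) + #{τ : Equiv.Perm (Fin n) |
      #{i ∈ diffSet π σ | τ i = π i} ≠ #{i ∈ diffSet π σ | τ i = σ i}} = n.factorial := by
    exact_mod_cast hc
  have hn' : (0 : ℝ) < 8 * n := by positivity
  rw [card_diffPattern]
  calc (#(balancedGuesses (diffPattern π σ)) : ℝ)
      ≤ n.factorial * (1 - #(diffSet π σ) / (8 * n)) := by
        have : (#(diffSet π σ) : ℝ) * n.factorial / (8 * n) ≤ #{τ : Equiv.Perm (Fin n) |
            #{i ∈ diffSet π σ | τ i = π i} ≠ #{i ∈ diffSet π σ | τ i = σ i}} := by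
          rw [div_le_iff₀ hn']; linarith
        have e : (n.factorial : ℝ) * (1 - #(diffSet π σ) / (8 * n))
            = n.factorial - (#(diffSet π σ) : ℝ) * n.factorial / (8 * n) := by ring
        rw [e]; linarith
    _ ≤ _ := by
        gcongr
        linarith [Real.add_one_le_exp (-(#(diffSet π σ) / (8 * n) : ℝ))]

open Finset in
theorem card_balancedGuesses_pow_le {n M : ℕ} (hn : 0 < n)
    (hM : 32 * n * Real.log n ≤ (M : ℝ)) (π σ : Equiv.Perm (Fin n)) :
    (#(balancedGuesses (diffPattern π σ)) : ℝ) ^ M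
      ≤ (n.factorial : ℝ) ^ M * (((n : ℝ) ^ 4)⁻¹) ^ #(diffPattern π σ) := by
  have hn0 : (0 : ℝ) < n := by positivity
  set d := #(diffPattern π σ)
  calc (#(balancedGuesses (diffPattern π σ)) : ℝ) ^ M
      ≤ (n.factorial * Real.exp (-(d / (8 * n) : ℝ))) ^ M := by
        gcongr
        exact card_balancedGuesses_le hn π σ
    _ = (n.factorial : ℝ) ^ M * Real.exp (M * -(d / (8 * n) : ℝ)) := by
        rw [mul_pow, ← Real.exp_nat_mul]
    _ ≤ (n.factorial : ℝ) ^ M * Real.exp (d * -(4 * Real.log n)) := by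
        have : (d : ℝ) * (4 * Real.log n) ≤ M * (d / (8 * n) : ℝ) := by
          rw [← mul_div_assoc, le_div_iff₀ (by positivity)]
          have := mul_le_mul_of_nonneg_left hM (show (0 : ℝ) ≤ d from Nat.cast_nonneg _)
          linarith
        refine mul_le_mul_of_nonneg_left (Real.exp_le_exp.2 ?_) (by positivity)
        linarith
    _ = (n.factorial : ℝ) ^ M * (((n : ℝ) ^ 4)⁻¹) ^ d := by
        have h4 : 4 * Real.log n = Real.log ((n : ℝ) ^ 4) := by
          rw [Real.log_pow]; norm_num
        rw [Real.exp_nat_mul, Real.exp_neg, h4, Real.exp_log (by positivity)]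

open Finset in
/-- The sets of triples together weigh `(1 + n⁻⁴) ^ n³ ≤ exp (1 / n)`, and removing the empty set
leaves less than `1`. -/
theorem sum_pattern_weight_lt_one {n : ℕ} (hn : 2 ≤ n)
    (P : Finset (Finset (Fin n × Fin n × Fin n))) (hne : ∅ ∉ P) :
    ∑ S ∈ P, (((n : ℝ) ^ 4)⁻¹) ^ #S < 1 := by
  have hn0 : (0 : ℝ) < n := by positivity
  set x : ℝ := ((n : ℝ) ^ 4)⁻¹ with hx
  have hx0 : 0 < x := by positivity
  have h1 : ∑ S ∈ insert ∅ P, x ^ #S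
      ≤ ∑ S ∈ (univ : Finset (Fin n × Fin n × Fin n)).powerset, x ^ #S :=
    sum_le_sum_of_subset_of_nonneg (fun S _ => mem_powerset.2 (subset_univ S))
      fun S _ _ => by positivity
  have h2 := sum_pow_mul_eq_add_pow x 1 (univ : Finset (Fin n × Fin n × Fin n))
  simp only [one_pow, mul_one] at h2
  rw [sum_insert hne, card_empty, pow_zero, h2] at h1
  have hcard : #(univ : Finset (Fin n × Fin n × Fin n)) = n * (n * n) := by
    simp
  have h3 : (x + 1) ^ (n * (n * n)) ≤ Real.exp (1 / n) := by
    calc (x + 1) ^ (n * (n * n)) ≤ Real.exp x ^ (n * (n * n)) := by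
          gcongr; exact Real.add_one_le_exp x
      _ = Real.exp (1 / n) := by
          rw [← Real.exp_nat_mul, hx]
          congr 1
          push_cast
          field_simp
  have h4 : Real.exp (1 / n) < 2 := by
    rw [← Real.lt_log_iff_exp_lt (by norm_num)]
    have h2n : (2 : ℝ) ≤ n := by exact_mod_cast hn
    have : (1 : ℝ) / n ≤ 1 / 2 := by gcongr
    linarith [Real.log_two_gt_d9]
  rw [hcard] at h1
  linarith

open Finset in
/-- A list of guesses chosen at random is correct with positive probability. The union bound runs
over the patterns of pairs of secrets rather than over the pairs themselves. -/
theorem exists_isCorrectStatic {n M : ℕ} (hn : 2 ≤ n)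
    (hM : 32 * n * Real.log n ≤ (M : ℝ)) :
    ∃ τ : Fin M → Equiv.Perm (Fin n), IsCorrectStatic τ := by
  classical
  obtain ⟨P, hP⟩ : ∃ P : Finset (Finset (Fin n × Fin n × Fin n)),
      ∀ S, S ∈ P ↔ ∃ π σ : Equiv.Perm (Fin n), π ≠ σ ∧ diffPattern π σ = S :=
    ⟨univ.filter fun S => ∃ π σ : Equiv.Perm (Fin n), π ≠ σ ∧ diffPattern π σ = S, by simp⟩
  have hN : (0 : ℝ) < (n.factorial : ℝ) ^ M := by positivity
  have hne : ∅ ∉ P := by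
    rw [hP]
    rintro ⟨π, σ, hne, h0⟩
    rw [← card_eq_zero, card_diffPattern, card_eq_zero, diffSet_eq_empty_iff] at h0
    exact hne h0
  have hsum := sum_pattern_weight_lt_one hn P hne
  have hlt : #(P.biUnion fun S => Fintype.piFinset fun _ : Fin M => balancedGuesses S)
      < Fintype.card (Fin M → Equiv.Perm (Fin n)) := by
    rw [← Nat.cast_lt (α := ℝ)]
    calc (#(P.biUnion fun S => Fintype.piFinset fun _ : Fin M => balancedGuesses S) : ℝ)
        ≤ ∑ S ∈ P, (#(balancedGuesses S) : ℝ) ^ M := by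
          refine (Nat.cast_le.2 card_biUnion_le).trans_eq ?_
          simp only [Fintype.card_piFinset_const, Nat.cast_sum, Nat.cast_pow]
      _ ≤ ∑ S ∈ P, (n.factorial : ℝ) ^ M * (((n : ℝ) ^ 4)⁻¹) ^ #S := by
          refine sum_le_sum fun S hS => ?_
          obtain ⟨π, σ, -, rfl⟩ := (hP S).1 hS
          exact card_balancedGuesses_pow_le (by lia) hM π σ
      _ = (n.factorial : ℝ) ^ M * ∑ S ∈ P, (((n : ℝ) ^ 4)⁻¹) ^ #S := by rw [mul_sum]
      _ < (n.factorial : ℝ) ^ M := mul_lt_of_lt_one_right hN hsum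
      _ = (Fintype.card (Fin M → Equiv.Perm (Fin n)) : ℝ) := by
          rw [Fintype.card_fun, Fintype.card_perm, Fintype.card_fin, Fintype.card_fin,
            Nat.cast_pow]
  obtain ⟨τ, -, hτ⟩ := exists_mem_notMem_of_card_lt_card (hlt.trans_eq card_univ.symm)
  refine ⟨τ, (isCorrectStatic_iff τ).2 fun π σ h => ?_⟩
  by_contra hne
  exact hτ (mem_biUnion.2 ⟨diffPattern π σ, (hP _).2 ⟨π, σ, hne, rfl⟩,
    Fintype.mem_piFinset.2 fun t => mem_balancedGuesses_of_blackPeg_eq (congrFun h t)⟩)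

theorem exists_staticLocalLength_le {n k : ℕ} (hn : 2 ≤ n) (hk : 2 ≤ k) :
    ∃ T ∈ staticLocalLengths n k, (T : ℝ)
      ≤ 28 * (n : ℝ) * Real.logb 2 (n : ℝ) * (⌈((n : ℝ) - 1) / ((k : ℝ) - 1)⌉ : ℝ) := by
  have h2n : (2 : ℝ) ≤ n := by exact_mod_cast hn
  have h2k : (2 : ℝ) ≤ k := by exact_mod_cast hk
  have hlog2 : 0 < Real.log 2 := Real.log_pos (by norm_num)
  have hlog : Real.log 2 ≤ Real.log n := Real.log_le_log (by norm_num) h2n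
  set M := ⌊28 * (n : ℝ) * Real.logb 2 (n : ℝ)⌋₊
  have hMle : (M : ℝ) ≤ 28 * (n : ℝ) * Real.logb 2 (n : ℝ) :=
    Nat.floor_le (mul_nonneg (by positivity) (Real.logb_nonneg (by norm_num) (by linarith)))
  have hMge : 32 * n * Real.log n ≤ (M : ℝ) := by
    -- `28 / log 2 ≥ 40`, and `8 n log n ≥ 1` pays for rounding down.
    have h1 := Nat.lt_floor_add_one (28 * (n : ℝ) * Real.logb 2 (n : ℝ))
    have h2 : 40 * (n * Real.log n) ≤ 28 * (n : ℝ) * Real.logb 2 (n : ℝ) := by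
      rw [Real.logb, ← mul_div_assoc, le_div_iff₀ hlog2]
      have : 0 ≤ n * Real.log n := by positivity
      nlinarith [Real.log_two_lt_d9]
    have h3 : 1 ≤ n * Real.log n := by nlinarith [Real.log_two_gt_d9]
    linarith
  set L := ⌈((n : ℝ) - 1) / ((k : ℝ) - 1)⌉₊ with hLdef
  have hpos : 0 < ((n : ℝ) - 1) / ((k : ℝ) - 1) := div_pos (by linarith) (by linarith)
  have hL : 0 < L := Nat.ceil_pos.2 hpos
  have hLcast : (L : ℝ) = (⌈((n : ℝ) - 1) / ((k : ℝ) - 1)⌉ : ℝ) :=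
    natCast_ceil_eq_intCast_ceil hpos.le
  have hnL : n ≤ 1 + L * (k - 1) := by
    have h1 := Nat.le_ceil (((n : ℝ) - 1) / ((k : ℝ) - 1))
    rw [div_le_iff₀ (by linarith)] at h1
    have h2 : (n : ℝ) ≤ ((1 + L * (k - 1) : ℕ) : ℝ) := by
      push_cast [Nat.cast_sub (show 1 ≤ k by lia)]
      linarith
    exact_mod_cast h2
  obtain ⟨τ, hτ⟩ := exists_isCorrectStatic hn hMge
  refine ⟨M * L, mul_mem_staticLocalLengths hk hL hnL τ hτ, ?_⟩
  rw [← hLcast]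
  push_cast
  gcongr

/-! ### Unvisited cells and the lower bound -/

open Finset in
/-- Two secrets that differ by exchanging the values of two positions are separated only by a guess
that visits one of the four cells involved; so for a correct strategy no rectangle is unvisited. -/
theorem exists_visited_of_isCorrectStatic {n T : ℕ} {π : Fin T → Equiv.Perm (Fin n)}
    (hπ : IsCorrectStatic π) {i j a b : Fin n} (hij : i ≠ j) (hab : a ≠ b) :
    ∃ t, π t i = a ∨ π t i = b ∨ π t j = a ∨ π t j = b := by
  classical
  by_contra! hcon
  rw [isCorrectStatic_iff] at hπ
  obtain ⟨σ, hσi, hσj⟩ : ∃ σ : Equiv.Perm (Fin n), σ i = a ∧ σ j = b := by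
    have hne : Equiv.swap i a j ≠ a := by
      intro h
      rw [Equiv.swap_apply_eq_iff, Equiv.swap_apply_right] at h
      exact hij h.symm
    refine ⟨Equiv.swap (Equiv.swap i a j) b * Equiv.swap i a, ?_, ?_⟩
    · rw [Equiv.Perm.mul_apply, Equiv.swap_apply_left,
        Equiv.swap_apply_of_ne_of_ne hne.symm hab]
    · rw [Equiv.Perm.mul_apply, Equiv.swap_apply_left]
  have heq : σ = σ * Equiv.swap i j := by
    apply hπ
    funext t
    refine congrArg Finset.card (filter_congr fun p _ => ?_)
    obtain ⟨h1, h2, h3, h4⟩ := hcon t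
    rw [Equiv.Perm.mul_apply]
    by_cases hpi : p = i
    · subst hpi; simp [hσi, hσj, h1, h2]
    · by_cases hpj : p = j
      · subst hpj; simp [hσi, hσj, h3, h4]
      · rw [Equiv.swap_apply_of_ne_of_ne hpi hpj]
  have := congrArg (fun ρ : Equiv.Perm (Fin n) => ρ i) heq
  simp only [Equiv.Perm.mul_apply, Equiv.swap_apply_left, hσi, hσj] at this
  exact hab this

open Finset in
/-- The Kővári–Sós–Turán bound: a set of cells of an `n × n` board without rectangles has at most
`n ^ (3 / 2) + n` elements, because every ordered pair of columns occurs in at most one row. -/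
theorem card_le_of_rectangle_free {n : ℕ} (U : Finset (Fin n × Fin n))
    (hU : ∀ i j a b, i ≠ j → a ≠ b → (i, a) ∈ U → (i, b) ∈ U → (j, a) ∈ U → (j, b) ∉ U) :
    (#U : ℝ) ≤ (n : ℝ) ^ (3 / 2 : ℝ) + n := by
  classical
  let R : Fin n → Finset (Fin n) := fun i => {a | (i, a) ∈ U}
  have hR : ∀ i a, a ∈ R i ↔ (i, a) ∈ U := by simp [R]
  have hcard : #U = ∑ i, #(R i) := by
    rw [card_eq_sum_card_fiberwise (f := Prod.fst) (t := univ) (by simp)]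
    refine sum_congr rfl fun i _ => ?_
    refine card_bij (fun p _ => p.2) ?_ ?_ ?_
    · rintro ⟨i', a⟩ h
      simp only [mem_filter] at h
      rw [hR, ← h.2]; exact h.1
    · rintro ⟨i', a⟩ h ⟨j', b⟩ h' hab
      simp only [mem_filter] at h h' hab
      rw [h.2, h'.2, hab]
    · intro a ha
      exact ⟨(i, a), by simpa [hR] using ha, rfl⟩
  have hpairs : ∑ i, #(R i).offDiag ≤ n * n - n := by
    rw [← card_biUnion]
    · calc _ ≤ #(univ : Finset (Fin n)).offDiag := card_le_card fun p hp => by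
            simp only [mem_biUnion, mem_offDiag] at hp ⊢
            obtain ⟨i, -, -, -, h⟩ := hp
            exact ⟨mem_univ _, mem_univ _, h⟩
        _ = n * n - n := by simp [offDiag_card]
    · intro i _ j _ hij
      rw [Function.onFun, Finset.disjoint_left]
      rintro ⟨a, b⟩ h h'
      simp only [mem_offDiag, hR] at h h'
      exact hU i j a b hij h.2.2 h.1 h.2.1 h'.1 h'.2.1
  have hsq : ∑ i, (#(R i) : ℝ) ^ 2 ≤ (n : ℝ) ^ 2 + #U := by
    have h1 : ∑ i, #(R i) ^ 2 = ∑ i, #(R i).offDiag + #U := by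
      rw [hcard, ← sum_add_distrib]
      refine sum_congr rfl fun i _ => ?_
      rw [offDiag_card, sq, Nat.sub_add_cancel (Nat.le_mul_self _)]
    have h2 : ∑ i, #(R i) ^ 2 ≤ n ^ 2 + #U := by
      rw [h1, sq]; lia
    exact_mod_cast h2
  have hcs := sq_sum_le_card_mul_sum_sq (s := univ) (f := fun i => (#(R i) : ℝ))
  rw [card_univ, Fintype.card_fin] at hcs
  have hu : (#U : ℝ) = ∑ i, (#(R i) : ℝ) := by rw [hcard]; push_cast; rfl
  rw [← hu] at hcs
  have hn0 : (0 : ℝ) ≤ n := n.cast_nonneg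
  set w := (n : ℝ) ^ (3 / 2 : ℝ) with hw
  have hw0 : 0 ≤ w := by positivity
  have hw2 : w ^ 2 = (n : ℝ) ^ 3 := by
    rw [hw, ← Real.rpow_natCast, ← Real.rpow_mul hn0]; norm_num
  -- The inequalities above amount to `u * (u - n) ≤ n ^ 3`.
  have hmul := mul_le_mul_of_nonneg_left hsq hn0
  by_contra! hcon
  have hprod : w * (w + n) ≤ (#U - n) * #U :=
    mul_le_mul (by linarith) hcon.le (by positivity) (by linarith)
  have hn1 : 0 < (n : ℝ) := by
    rcases hn0.lt_or_eq with h | h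
    · exact h
    · exfalso
      have : (#U : ℝ) = 0 := by
        have h0 : n = 0 := by exact_mod_cast h.symm
        subst h0
        simp [Finset.eq_empty_of_isEmpty U]
      linarith
  have hwpos : 0 < w := by positivity
  nlinarith [mul_pos hwpos hn1]

open Finset in
/-- Each guess visits at most `k` cells that the previous guess did not visit. -/
theorem card_visited_le {n T k : ℕ} {π : Fin T → Equiv.Perm (Fin n)} (hπ : IsLocal k π) :
    #{c : Fin n × Fin n | ∃ t, π t c.1 = c.2} ≤ n + T * k := by
  classical
  have key : ∀ m ≤ T, #{c : Fin n × Fin n | ∃ t : Fin T, t.1 < m ∧ π t c.1 = c.2} ≤ n + m * k := by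
    intro m hm
    induction m with
    | zero => simp
    | succ m ih =>
      have hmT : m < T := by lia
      rcases m with _ | m
      · have hsub : ({c : Fin n × Fin n | ∃ t : Fin T, t.1 < 0 + 1 ∧ π t c.1 = c.2} : Finset _)
            ⊆ univ.image fun i => (i, π ⟨0, hmT⟩ i) := by
          rintro ⟨i, a⟩ h
          obtain ⟨t, ht, h⟩ := (mem_filter.1 h).2
          have : t = ⟨0, hmT⟩ := Fin.ext (by simp at ht; simpa using ht)
          subst this
          simpa using h
        refine (card_le_card hsub).trans (card_image_le.trans ?_)
        simp
      · set s : Fin T := ⟨m, by lia⟩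
        set t : Fin T := ⟨m + 1, hmT⟩
        have hsub : ({c : Fin n × Fin n | ∃ r : Fin T, r.1 < m + 1 + 1 ∧ π r c.1 = c.2} : Finset _)
            ⊆ ({c : Fin n × Fin n | ∃ r : Fin T, r.1 < m + 1 ∧ π r c.1 = c.2} : Finset _)
              ∪ (diffSet (π s) (π t)).image fun i => (i, π t i) := by
          rintro ⟨i, a⟩ h
          obtain ⟨r, hr, h⟩ := (mem_filter.1 h).2
          rw [mem_union]
          rcases Nat.lt_or_ge r.1 (m + 1) with h' | h'
          · exact Or.inl ((mem_filter_univ _).2 ⟨r, h', h⟩)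
          · have : r = t := Fin.ext (show r.1 = m + 1 by lia)
            subst this
            by_cases hi : π s i = π t i
            · exact Or.inl ((mem_filter_univ _).2 ⟨s, Nat.lt_succ_self m, hi.trans h⟩)
            · refine Or.inr (mem_image.2 ⟨i, by simpa [diffSet] using hi, ?_⟩)
              exact Prod.ext rfl h
        have h1 := ih (by lia)
        have h2 := hπ s t rfl
        have h3 := (card_le_card hsub).trans (card_union_le _ _)
        have h4 := card_image_le (s := diffSet (π s) (π t)) (f := fun i => (i, π t i))
        have h5 : (m + 1 + 1) * k = (m + 1) * k + k := by ring
        lia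
  have h := key T le_rfl
  simpa using h

open Finset in
theorem le_mul_of_mem_staticLocalLengths {n k T : ℕ} (hT : T ∈ staticLocalLengths n k) :
    (n : ℝ) ^ 2 - (n : ℝ) ^ (3 / 2 : ℝ) - 2 * n ≤ T * k := by
  classical
  obtain ⟨π, hloc, hcor⟩ := hT
  have hU := card_le_of_rectangle_free ({c : Fin n × Fin n | ¬ ∃ t, π t c.1 = c.2} : Finset _) (by
    intro i j a b hij hab h1 h2 h3 h4
    simp only [mem_filter_univ, not_exists] at h1 h2 h3 h4
    obtain ⟨t, h | h | h | h⟩ := exists_visited_of_isCorrectStatic hcor hij hab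
    · exact h1 t h
    · exact h2 t h
    · exact h3 t h
    · exact h4 t h)
  have hV := card_visited_le hloc
  have hsum := card_filter_add_card_filter_not (s := (univ : Finset (Fin n × Fin n)))
    (fun c => ∃ t, π t c.1 = c.2)
  rw [card_univ, Fintype.card_prod, Fintype.card_fin] at hsum
  have hV' : (#{c : Fin n × Fin n | ∃ t, π t c.1 = c.2} : ℝ) ≤ n + T * k := by exact_mod_cast hV
  have hsum' : (#{c : Fin n × Fin n | ∃ t, π t c.1 = c.2} : ℝ)
      + #{c : Fin n × Fin n | ¬ ∃ t, π t c.1 = c.2} = n * n := by exact_mod_cast hsum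
  nlinarith

end PermMastermind

/-! ### The bounds combined -/

theorem theorem2 :
    ∃ ε : ℕ → ℝ, Tendsto ε atTop (𝓝 0) ∧
      ∀ n k : ℕ, 2 ≤ n → 2 ≤ k →
        (PermMastermind.staticLocalLengths n k).Nonempty ∧
        ((n : ℝ) ^ 2 - (1 + ε n) * (n : ℝ) ^ (3 / 2 : ℝ)) / (k : ℝ)
          ≤ (PermMastermind.staticLocalComplexity n k : ℝ) ∧
        (PermMastermind.staticLocalComplexity n k : ℝ)
          ≤ 28 * (n : ℝ) * Real.logb 2 (n : ℝ) * (⌈((n : ℝ) - 1) / ((k : ℝ) - 1)⌉ : ℝ) := by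
  refine ⟨fun n => 2 * (n : ℝ) ^ (-(1 / 2) : ℝ), ?_, fun n k hn hk => ?_⟩
  · have h := (tendsto_rpow_neg_atTop (show (0 : ℝ) < 1 / 2 by norm_num)).comp
      (tendsto_natCast_atTop_atTop (R := ℝ))
    simpa [Function.comp_def] using h.const_mul 2
  · obtain ⟨T, hT, hle⟩ := PermMastermind.exists_staticLocalLength_le hn hk
    have hne : (PermMastermind.staticLocalLengths n k).Nonempty := ⟨T, hT⟩
    have hn0 : (0 : ℝ) < n := by positivity
    refine ⟨hne, ?_, (Nat.cast_le.2 (Nat.sInf_le hT)).trans hle⟩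
    have hlow := PermMastermind.le_mul_of_mem_staticLocalLengths (Nat.sInf_mem hne)
    have hmul : (n : ℝ) ^ (-(1 / 2) : ℝ) * (n : ℝ) ^ (3 / 2 : ℝ) = n := by
      rw [← Real.rpow_add hn0]; norm_num
    rw [div_le_iff₀ (by positivity)]
    refine le_trans (le_of_eq ?_) hlow
    linear_combination (-2) * hmul
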